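/- Let $\Omega_+$ be either the open unit disc $\mathbb D$, with $\rho_\omega(\lambda)=1-\lambda\overline\omega$, or the open right half-plane $\{\lambda:\lambda+\overline\lambda>0\}$, with $\rho_\omega(\lambda)=2\pi(\lambda+\overline\omega)$, and let $\Omega_0$ be its boundary in $\mathbb C$. A kernel $\mathsf K_\omega(\lambda)$ on $D\times D$ with values in $\mathbb C^{m\times m}$ and $\mathsf K_\omega(\lambda)^*=\mathsf K_\lambda(\omega)$ has $\kappa$ negative squares if for all $n$, $\omega_1,\dots,\omega_n\in D$ and $u_1,\dots,u_n\in\mathbb C^m$ the Hermitian matrix $\big(u_k^*\mathsf K_{\omega_j}(\omega_k)u_j\big)_{j,k=1}^n$ has at most $\kappa$ negative eigenvalues (counted with multiplicity), and for some choice of these data exactly $\kappa$. For a matrix valued function $f$ meromorphic in $\Omega_+$, let $\mathfrak h_f^+\subseteq\Omega_+$ be its domain of holomorphy. Put $j_{pq}=\begin{bmatrix}I_p&0\\0&-I_q\end{bmatrix}$. * $\mathcal S_\kappa^{p\times q}$ is the class of $p\times q$ matrix valued functions $s$, meromorphic in $\Omega_+$, for which the kernel $\dfrac{I_p-s(\lambda)s(\omega)^*}{\rho_\omega(\lambda)}$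 has $\kappa$ negative squares on $\mathfrak h_s^+\times\mathfrak h_s^+$. * $\mathcal U_\kappa(j_{pq})$ is the class of $(p+q)\times(p+q)$ matrix valued functions $W$, meromorphic in $\Omega_+$, for which the kernel $\dfrac{j_{pq}-W(\lambda)j_{pq}W(\omega)^*}{\rho_\omega(\lambda)}$ has $\kappa$ negative squares on $\mathfrak h_W^+\times\mathfrak h_W^+$ and whose nontangential boundary values $W(\mu)$ exist and satisfy $j_{pq}-W(\mu)j_{pq}W(\mu)^*=0$ for a.e. $\mu\in\Omega_0$. * A $p\times(p+q)$ matrix valued function $X$, meromorphic in $\Omega_+$, is $(\Omega_+,j_{pq})_\kappa$-admissible if the kernel $\dfrac{X(\lambda)j_{pq}X(\omega)^*}{\rho_\omega(\lambda)}$ has $\kappa$ negative squares on $\mathfrak h_X^+\times\mathfrak h_X^+$. * For $W=\begin{bmatrix}w_{11}&w_{12}\\w_{21}&w_{22}\end{bmatrix}$, with $w_{11}$ of size $p\times p$ and $w_{22}$ of size $q\times q$, let $T_W[\varepsilon]=(w_{11}\varepsilon+w_{12})(w_{21}\varepsilon+w_{22})^{-1}$, and let $T_W[\mathcal S_\kappa^{p\times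 q}]$ be the set of the meromorphic functions $T_W[\varepsilon]$, where $\varepsilon\in\mathcal S_\kappa^{p\times q}$ and $w_{21}\varepsilon+w_{22}$ is invertible off a discrete subset of $\Omega_+$. **Theorem.** Let $\kappa_1\le\kappa$ be nonnegative integers, let $s\in\mathcal S_\kappa^{p\times q}$ and let $W\in\mathcal U_{\kappa_1}(j_{pq})$. Then $s\in T_W[\mathcal S_{\kappa-\kappa_1}^{p\times q}]$ if and only if $\begin{bmatrix}I_p&-s\end{bmatrix}W$ is $(\Omega_+,j_{pq})_{\kappa-\kappa_1}$-admissible. -/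

import Mathlib

open Filter Topology MeasureTheory
open scoped Matrix

noncomputable section

namespace GenSchur

/-- The two choices of the domain: the open unit disc and the open right half-plane. -/
inductive Region where
  | disk
  | halfPlane

namespace Region

/-- The open set `Ω₊`. -/
def carrier : Region → Set ℂ
  | disk => {z | ‖z‖ < 1}
  | halfPlane => {z | 0 < z.re}

/-- `ρ_ω(l)`, that is `1 - l * conj ω` for the disc and `2π (l + conj ω)` for the half-plane. -/
def rho : Region → ℂ → ℂ → ℂ
  | disk, ω, l => 1 - l * (starRingEnd ℂ) ω
  | halfPlane, ω, l => 2 * (Real.pi : ℂ) * (l + (starRingEnd ℂ) ω)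

/-- Parametrization of the boundary `Ω₀` by the real line: `t ↦ e^{it}`, respectively `t ↦ it`.
A property holds a.e. on `Ω₀` iff it holds at `bdryPoint t` for Lebesgue almost every `t`. -/
def bdryPoint : Region → ℝ → ℂ
  | disk, t => Complex.exp (t * Complex.I)
  | halfPlane, t => t * Complex.I

/-- Distance of a point of `Ω₊` to the boundary `Ω₀`. -/
def bdryDist : Region → ℂ → ℝ
  | disk, z => 1 - ‖z‖
  | halfPlane, z => z.re

/-- The nontangential approach region (Stolz angle) of aperture `M` at the boundary point `μ`. -/
def stolz (Ω : Region) (M : ℝ) (μ : ℂ) : Set ℂ :=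
  {z | z ∈ Ω.carrier ∧ ‖z - μ‖ < M * Ω.bdryDist z}

end Region

/-! Meromorphic matrix valued functions. They are represented by functions on `ℂ` with values in
matrices, two of them being regarded as equal on `Ω` if they agree off a discrete subset of `Ω`. -/

/-- All entries of `f` are meromorphic on `U`. -/
def MatMeromorphicOn {m n : Type*} (f : ℂ → Matrix m n ℂ) (U : Set ℂ) : Prop :=
  ∀ i j, MeromorphicOn (fun z => f z i j) U

/-- The canonical representative of a meromorphic matrix valued function on `U`: removable
singularities of the entries are removed (and entries get the value `0` at their poles). -/
def matNF {m n : Type*} (U : Set ℂ) (f : ℂ → Matrix m n ℂ) : ℂ → Matrix m n ℂ :=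
  fun z => Matrix.of fun i j => toMeromorphicNFOn (fun w => f w i j) U z

/-- The domain of holomorphy of the meromorphic matrix valued function `f` in `U`. -/
def holDomain {m n : Type*} (U : Set ℂ) (f : ℂ → Matrix m n ℂ) : Set ℂ :=
  {z | z ∈ U ∧ ∀ i j, AnalyticAt ℂ (fun w => matNF U f w i j) z}

/-- `L` is the nontangential limit of the meromorphic matrix valued function `f` on `Ω` at the
boundary point `μ`. -/
def HasNontangentialLimit {m n : Type*} (Ω : Region) (f : ℂ → Matrix m n ℂ) (μ : ℂ)
    (L : Matrix m n ℂ) : Prop :=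
  ∀ M : ℝ, 1 < M → ∀ i j,
    Tendsto (fun z => matNF Ω.carrier f z i j) (𝓝[Ω.stolz M μ] μ) (𝓝 (L i j))

/-! Kernels and their negative squares. The value `𝖪_ω(l)` of a kernel is written `K ω l`. -/

/-- The kernel `K` is Hermitian on `D`. -/
def IsHermitianKernel {m : Type*} (K : ℂ → ℂ → Matrix m m ℂ) (D : Set ℂ) : Prop :=
  ∀ ω ∈ D, ∀ l ∈ D, (K ω l)ᴴ = K l ω

/-- The matrix with the entries `⟨K_{ω_j}(ω_k) u_j, u_k⟩ = u_k^* K_{ω_j}(ω_k) u_j`. -/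
def kernelGram {m : Type*} [Fintype m] (K : ℂ → ℂ → Matrix m m ℂ) {n : ℕ}
    (ω : Fin n → ℂ) (u : Fin n → m → ℂ) : Matrix (Fin n) (Fin n) ℂ :=
  Matrix.of fun j k => star (u k) ⬝ᵥ (K (ω j) (ω k) *ᵥ u j)

theorem IsHermitianKernel.gram {m : Type*} [Fintype m] {K : ℂ → ℂ → Matrix m m ℂ} {D : Set ℂ}
    (hK : IsHermitianKernel K D) {n : ℕ} {ω : Fin n → ℂ} (hω : ∀ j, ω j ∈ D)
    (u : Fin n → m → ℂ) : (kernelGram K ω u).IsHermitian := by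
  ext j k
  simp only [Matrix.conjTranspose_apply, kernelGram, Matrix.of_apply]
  rw [← hK _ (hω k) _ (hω j), ← Matrix.star_dotProduct_star, star_star, Matrix.star_mulVec,
    dotProduct_comm, Matrix.dotProduct_mulVec]
  exact dotProduct_comm _ _

/-- The number of negative eigenvalues, counted with multiplicity, of a Hermitian matrix. -/
def negCount {n : ℕ} {A : Matrix (Fin n) (Fin n) ℂ} (hA : A.IsHermitian) : ℕ :=
  (Finset.univ.filter fun i => hA.eigenvalues i < 0).card

/-- `K` is a Hermitian kernel on `D` that has (exactly) `κ` negative squares. -/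
structure HasNegSquares {m : Type*} [Fintype m] (K : ℂ → ℂ → Matrix m m ℂ) (D : Set ℂ)
    (κ : ℕ) : Prop where
  hermitian : IsHermitianKernel K D
  le : ∀ (n : ℕ) (ω : Fin n → ℂ) (u : Fin n → m → ℂ) (hω : ∀ j, ω j ∈ D),
    negCount (hermitian.gram hω u) ≤ κ
  attained : ∃ (n : ℕ) (ω : Fin n → ℂ) (u : Fin n → m → ℂ) (hω : ∀ j, ω j ∈ D),
    negCount (hermitian.gram hω u) = κ

/-! The classes of matrix valued functions. -/

/-- The kernel `(I - s(l) s(ω)^*) / ρ_ω(l)`. -/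
def schurKernel {p q : ℕ} (Ω : Region) (s : ℂ → Matrix (Fin p) (Fin q) ℂ) :
    ℂ → ℂ → Matrix (Fin p) (Fin p) ℂ :=
  fun ω l => (Ω.rho ω l)⁻¹ • (1 - s l * (s ω)ᴴ)

/-- The generalized Schur class `S_κ^{p×q}(Ω₊)`. -/
structure IsGenSchur {p q : ℕ} (Ω : Region) (κ : ℕ) (s : ℂ → Matrix (Fin p) (Fin q) ℂ) :
    Prop where
  meromorphic : MatMeromorphicOn s Ω.carrier
  negSquares : HasNegSquares (schurKernel Ω (matNF Ω.carrier s)) (holDomain Ω.carrier s) κ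

/-- The kernel `(J - W(l) J W(ω)^*) / ρ_ω(l)`. -/
def innerKernel {m : Type*} [Fintype m] (Ω : Region) (J : Matrix m m ℂ)
    (W : ℂ → Matrix m m ℂ) : ℂ → ℂ → Matrix m m ℂ :=
  fun ω l => (Ω.rho ω l)⁻¹ • (J - W l * J * (W ω)ᴴ)

/-- The class `U_κ(J)` of generalized `J`-inner functions (for a signature matrix `J`). -/
structure IsGenInner {m : Type*} [Fintype m] (Ω : Region) (κ : ℕ) (J : Matrix m m ℂ)
    (W : ℂ → Matrix m m ℂ) : Prop where
  meromorphic : MatMeromorphicOn W Ω.carrier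
  negSquares : HasNegSquares (innerKernel Ω J (matNF Ω.carrier W)) (holDomain Ω.carrier W) κ
  boundary : ∀ᵐ t : ℝ, ∃ L : Matrix m m ℂ,
    HasNontangentialLimit Ω W (Ω.bdryPoint t) L ∧ J - L * J * Lᴴ = 0

/-- The kernel `X(l) J X(ω)^* / ρ_ω(l)`. -/
def admKernel {r m : Type*} [Fintype m] (Ω : Region) (J : Matrix m m ℂ)
    (X : ℂ → Matrix r m ℂ) : ℂ → ℂ → Matrix r r ℂ :=
  fun ω l => (Ω.rho ω l)⁻¹ • (X l * J * (X ω)ᴴ)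

/-- `X` is `(Ω₊, J)_κ`-admissible. -/
structure IsAdmissible {r m : Type*} [Fintype r] [Fintype m] (Ω : Region) (J : Matrix m m ℂ)
    (κ : ℕ) (X : ℂ → Matrix r m ℂ) : Prop where
  meromorphic : MatMeromorphicOn X Ω.carrier
  negSquares : HasNegSquares (admKernel Ω J (matNF Ω.carrier X)) (holDomain Ω.carrier X) κ

/-- The signature matrix `j_{pq}`. -/
def jpq (p q : ℕ) : Matrix (Fin p ⊕ Fin q) (Fin p ⊕ Fin q) ℂ :=
  Matrix.fromBlocks 1 0 0 (-1)

/-! Linear fractional transformations. -/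

/-- The denominator `w₂₁ ε + w₂₂`. -/
def lftDenom {p q : ℕ} (W : ℂ → Matrix (Fin p ⊕ Fin q) (Fin p ⊕ Fin q) ℂ)
    (ε : ℂ → Matrix (Fin p) (Fin q) ℂ) : ℂ → Matrix (Fin q) (Fin q) ℂ :=
  fun z => (W z).toBlocks₂₁ * ε z + (W z).toBlocks₂₂

/-- `T_W[ε] = (w₁₁ ε + w₁₂) (w₂₁ ε + w₂₂)⁻¹`. -/
def lft {p q : ℕ} (W : ℂ → Matrix (Fin p ⊕ Fin q) (Fin p ⊕ Fin q) ℂ)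
    (ε : ℂ → Matrix (Fin p) (Fin q) ℂ) : ℂ → Matrix (Fin p) (Fin q) ℂ :=
  fun z => ((W z).toBlocks₁₁ * ε z + (W z).toBlocks₁₂) * (lftDenom W ε z)⁻¹

/-- The set `T_W[S_κ^{p×q}]`: the functions `s` such that for some `ε` in `S_κ^{p×q}` the
transform `T_W[ε]` is defined off a discrete subset of `Ω₊` and `s = T_W[ε]` as meromorphic
functions on `Ω₊`. -/
def lftImage {p q : ℕ} (Ω : Region) (W : ℂ → Matrix (Fin p ⊕ Fin q) (Fin p ⊕ Fin q) ℂ)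
    (κ : ℕ) : Set (ℂ → Matrix (Fin p) (Fin q) ℂ) :=
  {s | ∃ ε : ℂ → Matrix (Fin p) (Fin q) ℂ, IsGenSchur Ω κ ε ∧
    ∀ᶠ z in codiscreteWithin Ω.carrier, IsUnit (lftDenom W ε z).det ∧ s z = lft W ε z}

end GenSchur

end

open GenSchur

namespace GenSchur

/-! Write `X = [I, -s] W = [x₁, x₂]`. Where the denominator is invertible, `s = T_W[ε]` says that
`X` annihilates the column `[ε; I]`, that is `x₁ ε + x₂ = 0`, so `X = x₁ [I, -ε]`. Then `X(λ) j
X(ω)^* = x₁(λ) (I - ε(λ) ε(ω)^*) x₁(ω)^*`, and where `x₁` is invertible this congruence preserves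
the number of negative squares (`HasNegSquares.of_congruence`, `isAdmissible_iff_isGenSchur`). Hence
everything rests on the generic invertibility of `x₁`.

The `j`-unitary boundary values make `W` generically invertible, so `X` generically has full row
rank. If `ε` is given, the factorization then forces `x₁` to be invertible. If instead `X` is
admissible and `det x₁` vanished identically, then at infinitely many points some `u` would give
`X^* u = (0, y)` with `y ≠ 0`. The Gram matrix at any `N` such points is `-(y_k^* y_j) / ρ`, which
is negative definite because the Szegő kernel is strictly positive (`negCount_eq_of_szego`). Taking
`N` beyond the allowed count is a contradiction, and `ε = -x₁⁻¹ x₂` is the required parameter.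

Exceptional discrete sets are harmless: the negative eigenvalue count is lower semicontinuous, so a
continuous kernel has the same negative squares on a dense subset (`hasNegSquares_iff_of_dense`). -/

/-! ### Negative eigenvalues and negative subspaces. -/

theorem quadForm_eq_sum_eigenvalues {n : ℕ} {A : Matrix (Fin n) (Fin n) ℂ} (hA : A.IsHermitian)
    (x : Fin n → ℂ) :
    (star x ⬝ᵥ (A *ᵥ x)).re =
      ∑ i, hA.eigenvalues i *
        ‖((hA.eigenvectorUnitary : Matrix (Fin n) (Fin n) ℂ)ᴴ *ᵥ x) i‖ ^ 2 := by
  set U : Matrix (Fin n) (Fin n) ℂ := (hA.eigenvectorUnitary : Matrix (Fin n) (Fin n) ℂ) with hU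
  have hs : A = U * Matrix.diagonal (fun i => (hA.eigenvalues i : ℂ)) * Uᴴ := by
    have h := hA.spectral_theorem
    rw [Unitary.conjStarAlgAut_apply] at h
    exact h
  have h1 : star x ⬝ᵥ (A *ᵥ x) =
      star (Uᴴ *ᵥ x) ⬝ᵥ (Matrix.diagonal (fun i => (hA.eigenvalues i : ℂ)) *ᵥ (Uᴴ *ᵥ x)) := by
    conv_lhs => rw [hs]
    rw [Matrix.star_mulVec, Matrix.conjTranspose_conjTranspose, ← Matrix.dotProduct_mulVec,
      Matrix.mulVec_mulVec, Matrix.mulVec_mulVec, Matrix.mul_assoc]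
  rw [h1]
  simp only [dotProduct, Matrix.mulVec_diagonal, Pi.star_apply, Complex.re_sum]
  refine Finset.sum_congr rfl fun i _ => ?_
  rw [mul_left_comm, RCLike.star_def, Complex.conj_mul', ← Complex.ofReal_pow,
    ← Complex.ofReal_mul, Complex.ofReal_re]

/-- A vector `B y` without components along the negative eigenvectors has a nonnegative form. So the
projection of the range of `B` to those components is injective. -/
theorem card_le_negCount {n : ℕ} {A : Matrix (Fin n) (Fin n) ℂ} (hA : A.IsHermitian)
    {ι : Type*} [Fintype ι] (B : Matrix (Fin n) ι ℂ)
    (hB : ∀ y, y ≠ 0 → (star (B *ᵥ y) ⬝ᵥ (A *ᵥ (B *ᵥ y))).re < 0) :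
    Fintype.card ι ≤ negCount hA := by
  set U : Matrix (Fin n) (Fin n) ℂ := (hA.eigenvectorUnitary : Matrix (Fin n) (Fin n) ℂ) with hU
  let M : Matrix {i // hA.eigenvalues i < 0} ι ℂ := (Uᴴ * B).submatrix Subtype.val id
  have hM : Function.Injective M.mulVecLin := by
    rw [← LinearMap.ker_eq_bot, LinearMap.ker_eq_bot']
    intro y hy
    by_contra hne
    have h := hB y hne
    rw [quadForm_eq_sum_eigenvalues hA] at h
    refine absurd h (not_lt.2 (Finset.sum_nonneg fun i _ => ?_))
    by_cases hi : hA.eigenvalues i < 0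
    · have h2 : (Uᴴ *ᵥ (B *ᵥ y)) i = 0 := by
        have := congrFun hy ⟨i, hi⟩
        rw [Matrix.mulVec_mulVec]
        exact this
      rw [h2]; simp
    · exact mul_nonneg (not_lt.1 hi) (by positivity)
  have := LinearMap.finrank_le_finrank_of_injective hM
  rw [Module.finrank_fintype_fun_eq_card, Module.finrank_fintype_fun_eq_card,
    Fintype.card_subtype] at this
  exact this

theorem exists_negative_subspace {n : ℕ} {A : Matrix (Fin n) (Fin n) ℂ} (hA : A.IsHermitian) :
    ∃ B : Matrix (Fin n) {i // hA.eigenvalues i < 0} ℂ,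
      ∀ y, y ≠ 0 → (star (B *ᵥ y) ⬝ᵥ (A *ᵥ (B *ᵥ y))).re < 0 := by
  set U : Matrix (Fin n) (Fin n) ℂ := (hA.eigenvectorUnitary : Matrix (Fin n) (Fin n) ℂ) with hU
  have hUU : Uᴴ * U = 1 := Unitary.coe_star_mul_self hA.eigenvectorUnitary
  refine ⟨U.submatrix id Subtype.val, fun y hy => ?_⟩
  have hE : Uᴴ *ᵥ (U.submatrix id Subtype.val *ᵥ y) =
      ((1 : Matrix (Fin n) (Fin n) ℂ).submatrix id
        (Subtype.val : {i // hA.eigenvalues i < 0} → Fin n)) *ᵥ y := by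
    rw [Matrix.mulVec_mulVec]
    congr 1
    rw [← hUU]
    rfl
  rw [quadForm_eq_sum_eigenvalues hA, hE]
  have hz : ∀ i, ¬ hA.eigenvalues i < 0 →
      (((1 : Matrix (Fin n) (Fin n) ℂ).submatrix id
        (Subtype.val : {i // hA.eigenvalues i < 0} → Fin n)) *ᵥ y) i = 0 := by
    intro i hi
    simp only [Matrix.mulVec, dotProduct, Matrix.submatrix_apply]
    refine Finset.sum_eq_zero fun j _ => ?_
    have : i ≠ j.1 := fun h => hi (h ▸ j.2)
    rw [id, Matrix.one_apply_ne this, zero_mul]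
  have hv : ∀ i : {i // hA.eigenvalues i < 0},
      (((1 : Matrix (Fin n) (Fin n) ℂ).submatrix id
        (Subtype.val : {i // hA.eigenvalues i < 0} → Fin n)) *ᵥ y) i.1 = y i := by
    intro i
    simp only [Matrix.mulVec, dotProduct, Matrix.submatrix_apply]
    rw [Finset.sum_eq_single i]
    · rw [id, Matrix.one_apply_eq, one_mul]
    · intro j _ hj
      rw [id, Matrix.one_apply_ne (fun h => hj (Subtype.ext h.symm)), zero_mul]
    · simp
  obtain ⟨i, hi⟩ := Function.ne_iff.1 hy
  refine Finset.sum_neg' (fun j _ => ?_) ⟨i.1, Finset.mem_univ _, ?_⟩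
  · by_cases hj : hA.eigenvalues j < 0
    · exact mul_nonpos_of_nonpos_of_nonneg hj.le (by positivity)
    · rw [hz j hj]; simp
  · rw [hv i]
    exact mul_neg_of_neg_of_pos i.2 (by have := norm_pos_iff.2 hi; positivity)

/-- Strict negativity on the compact unit sphere of a maximal negative subspace survives small
perturbations of the matrix. -/
theorem eventually_negCount_le {n : ℕ} {A : Matrix (Fin n) (Fin n) ℂ} (hA : A.IsHermitian) :
    ∀ᶠ A' in 𝓝 A, ∀ hA' : A'.IsHermitian, negCount hA ≤ negCount hA' := by
  obtain ⟨B, hB⟩ := exists_negative_subspace hA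
  have hc : IsCompact (Metric.sphere (0 : {i // hA.eigenvalues i < 0} → ℂ) 1) :=
    isCompact_sphere _ _
  have hcont : Continuous fun z : Matrix (Fin n) (Fin n) ℂ × ({i // hA.eigenvalues i < 0} → ℂ) =>
      (star (B *ᵥ z.2) ⬝ᵥ (z.1 *ᵥ (B *ᵥ z.2))).re := by
    fun_prop
  have hev := hc.eventually_forall_of_forall_eventually (x₀ := A)
    (P := fun A' y => (star (B *ᵥ y) ⬝ᵥ (A' *ᵥ (B *ᵥ y))).re < 0) (fun y hy => by
      refine hcont.continuousAt.eventually_lt continuousAt_const (hB y ?_)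
      rintro rfl
      simp at hy)
  filter_upwards [hev] with A' h hA'
  have := card_le_negCount hA' B fun y hy => ?_
  · rwa [Fintype.card_subtype] at this
  -- The form scales by a positive factor when `y` is normalized, so its sign is decided on the
  -- sphere.
  have hn : 0 < ‖y‖ := norm_pos_iff.2 hy
  have h1 := h (((‖y‖ : ℂ)⁻¹) • y) (by
    simp [norm_smul, hn.ne'])
  simp only [Matrix.mulVec_smul, star_smul, smul_dotProduct, dotProduct_smul] at h1
  have h2 : ((‖y‖ : ℂ)⁻¹ • star ((‖y‖ : ℂ)⁻¹) • (star (B *ᵥ y) ⬝ᵥ A' *ᵥ B *ᵥ y)) =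
      ((‖y‖⁻¹ * ‖y‖⁻¹ : ℝ) : ℂ) * (star (B *ᵥ y) ⬝ᵥ A' *ᵥ B *ᵥ y) := by
    simp [mul_assoc]
  rw [h2, Complex.re_ofReal_mul] at h1
  by_contra hcon
  exact absurd h1 (not_lt.2 (mul_nonneg (by positivity) (not_lt.1 hcon)))

theorem negCount_congr {n : ℕ} {A A' : Matrix (Fin n) (Fin n) ℂ} (hA : A.IsHermitian)
    (hA' : A'.IsHermitian) (h : A = A') : negCount hA = negCount hA' := by
  subst h; rfl

/-! ### Negative squares: dense subsets and congruence. -/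

/-- The points are moved into `D₀` with the vectors `u` kept; the Gram matrices converge and the
count is lower semicontinuous. -/
theorem exists_negCount_le_of_dense {m : Type*} [Fintype m] {K : ℂ → ℂ → Matrix m m ℂ}
    {D D₀ : Set ℂ} (hK : IsHermitianKernel K D) (hsub : D₀ ⊆ D) (hdense : D ⊆ closure D₀)
    (hcont : ∀ i j, ContinuousOn (fun z : ℂ × ℂ => K z.1 z.2 i j) (D ×ˢ D))
    {n : ℕ} (ω : Fin n → ℂ) (u : Fin n → m → ℂ) (hω : ∀ j, ω j ∈ D) :
    ∃ (ω' : Fin n → ℂ) (hω' : ∀ j, ω' j ∈ D₀),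
      negCount (hK.gram hω u) ≤ negCount (hK.gram (fun j => hsub (hω' j)) u) := by
  have hcl : ω ∈ closure (Set.univ.pi fun _ : Fin n => D₀) := by
    rw [closure_pi_set]
    exact fun j _ => hdense (hω j)
  have : (𝓝[Set.univ.pi fun _ : Fin n => D₀] ω).NeBot := mem_closure_iff_nhdsWithin_neBot.1 hcl
  have hent : ∀ j k i i', Tendsto (fun w : Fin n → ℂ => K (w j) (w k) i i')
      (𝓝[Set.univ.pi fun _ : Fin n => D₀] ω) (𝓝 (K (ω j) (ω k) i i')) := by
    intro j k i i'
    have h1 := hcont i i' (ω j, ω k) ⟨hω j, hω k⟩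
    refine Tendsto.comp (f := fun w : Fin n → ℂ => (w j, w k)) h1 (tendsto_nhdsWithin_iff.2 ⟨?_, ?_⟩)
    · exact ((by fun_prop : Continuous fun w : Fin n → ℂ => (w j, w k)).tendsto ω).mono_left
        nhdsWithin_le_nhds
    · filter_upwards [self_mem_nhdsWithin] with w hw
      exact ⟨hsub (hw j trivial), hsub (hw k trivial)⟩
  have ht : Tendsto (fun w : Fin n → ℂ => kernelGram K w u)
      (𝓝[Set.univ.pi fun _ : Fin n => D₀] ω) (𝓝 (kernelGram K ω u)) := by
    refine tendsto_pi_nhds.2 fun j => tendsto_pi_nhds.2 fun k => ?_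
    simp only [kernelGram, Matrix.of_apply, dotProduct, Matrix.mulVec]
    exact tendsto_finsetSum _ fun a _ => tendsto_const_nhds.mul
      (tendsto_finsetSum _ fun b _ => (hent j k a b).mul tendsto_const_nhds)
  obtain ⟨w, hw, hwm⟩ :=
    ((ht.eventually (eventually_negCount_le (hK.gram hω u))).and self_mem_nhdsWithin).exists
  exact ⟨w, fun j => hwm j trivial, hw _⟩

theorem hasNegSquares_iff_of_dense {m : Type*} [Fintype m] {K : ℂ → ℂ → Matrix m m ℂ}
    {D D₀ : Set ℂ} (hK : IsHermitianKernel K D) (hsub : D₀ ⊆ D) (hdense : D ⊆ closure D₀)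
    (hcont : ∀ i j, ContinuousOn (fun z : ℂ × ℂ => K z.1 z.2 i j) (D ×ˢ D)) (κ : ℕ) :
    HasNegSquares K D κ ↔ HasNegSquares K D₀ κ := by
  constructor
  · intro h
    have hK₀ : IsHermitianKernel K D₀ := fun ω hω l hl => hK ω (hsub hω) l (hsub hl)
    have hle : ∀ (n : ℕ) (ω : Fin n → ℂ) (u : Fin n → m → ℂ) (hω : ∀ j, ω j ∈ D₀),
        negCount (hK₀.gram hω u) ≤ κ := fun n ω u hω => h.le n ω u fun j => hsub (hω j)
    refine ⟨hK₀, hle, ?_⟩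
    obtain ⟨n, ω, u, hω, hn⟩ := h.attained
    obtain ⟨ω', hω', hn'⟩ := exists_negCount_le_of_dense hK hsub hdense hcont ω u hω
    exact ⟨n, ω', u, hω', le_antisymm (hle _ _ _ hω') (hn.symm.le.trans hn')⟩
  · intro h
    refine ⟨hK, fun n ω u hω => ?_, ?_⟩
    · obtain ⟨ω', hω', hn'⟩ := exists_negCount_le_of_dense hK hsub hdense hcont ω u hω
      exact hn'.trans (h.le n ω' u hω')
    · obtain ⟨n, ω, u, hω, hn⟩ := h.attained
      exact ⟨n, ω, u, fun j => hsub (hω j), hn⟩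

/-- The factor `a` is absorbed into the vectors, `u ↦ a^* u`. As `a^* b^* = 1`, every choice of
vectors for `K` arises in this way. -/
theorem HasNegSquares.of_congruence {m : Type*} [Fintype m] [DecidableEq m]
    {K K' : ℂ → ℂ → Matrix m m ℂ} {D : Set ℂ} (a b : ℂ → Matrix m m ℂ) (hb : ∀ z ∈ D, b z * a z = 1)
    (hKK' : ∀ ω ∈ D, ∀ l ∈ D, K' ω l = a l * K ω l * (a ω)ᴴ) {κ : ℕ}
    (h : HasNegSquares K D κ) : HasNegSquares K' D κ := by
  have hK' : IsHermitianKernel K' D := by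
    intro ω hω l hl
    rw [hKK' ω hω l hl, hKK' l hl ω hω, ← h.hermitian ω hω l hl]
    simp [Matrix.conjTranspose_mul, Matrix.mul_assoc]
  have hgram : ∀ (n : ℕ) (ω : Fin n → ℂ) (u : Fin n → m → ℂ), (∀ j, ω j ∈ D) →
      kernelGram K' ω u = kernelGram K ω fun j => (a (ω j))ᴴ *ᵥ u j := by
    intro n ω u hω
    ext j k
    simp only [kernelGram, Matrix.of_apply]
    rw [hKK' _ (hω j) _ (hω k), Matrix.star_mulVec, Matrix.conjTranspose_conjTranspose,
      ← Matrix.dotProduct_mulVec, Matrix.mulVec_mulVec, Matrix.mulVec_mulVec, Matrix.mul_assoc]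
  refine ⟨hK', fun n ω u hω => ?_, ?_⟩
  · rw [negCount_congr (hK'.gram hω u) (h.hermitian.gram hω _) (hgram n ω u hω)]
    exact h.le _ _ _ hω
  · obtain ⟨n, ω, u, hω, hn⟩ := h.attained
    refine ⟨n, ω, fun j => (b (ω j))ᴴ *ᵥ u j, hω, ?_⟩
    rw [← hn]
    refine negCount_congr _ _ ?_
    rw [hgram n ω _ hω]
    congr 1
    funext j
    rw [Matrix.mulVec_mulVec, ← Matrix.conjTranspose_mul, hb _ (hω j),
      Matrix.conjTranspose_one, Matrix.one_mulVec]

/-! ### Strict positivity of the Szegő kernel. -/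

theorem hasSum_szego {N : ℕ} {z : Fin N → ℂ} (hz : ∀ j, ‖z j‖ < 1) (a : Fin N → ℂ) :
    HasSum (fun n : ℕ => ‖∑ j, a j * z j ^ n‖ ^ 2)
      (∑ j, ∑ k, a j * star (a k) * (1 - z j * star (z k))⁻¹).re := by
  have h : HasSum (fun n : ℕ => ((‖∑ j, a j * z j ^ n‖ ^ 2 : ℝ) : ℂ))
      (∑ j, ∑ k, a j * star (a k) * (1 - z j * star (z k))⁻¹) := by
    have h1 : HasSum (fun n : ℕ => ∑ j, ∑ k, a j * star (a k) * (z j * star (z k)) ^ n)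
        (∑ j, ∑ k, a j * star (a k) * (1 - z j * star (z k))⁻¹) := by
      refine hasSum_sum fun j _ => hasSum_sum fun k _ => HasSum.mul_left _ ?_
      refine hasSum_geometric_of_norm_lt_one ?_
      rw [norm_mul, norm_star]
      exact mul_lt_one_of_nonneg_of_lt_one_left (norm_nonneg _) (hz j) (hz k).le
    convert! h1 using 2 with n
    rw [Complex.ofReal_pow, ← Complex.mul_conj', ← RCLike.star_def, star_sum, Finset.sum_mul_sum]
    refine Finset.sum_congr rfl fun j _ => Finset.sum_congr rfl fun k _ => ?_
    rw [star_mul', star_pow, mul_pow]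
    ring
  exact Complex.hasSum_re h

theorem szego_nonneg {N : ℕ} {z : Fin N → ℂ} (hz : ∀ j, ‖z j‖ < 1) (a : Fin N → ℂ) :
    0 ≤ (∑ j, ∑ k, a j * star (a k) * (1 - z j * star (z k))⁻¹).re :=
  (hasSum_szego hz a).nonneg fun _ => by positivity

/-- A zero value kills every power sum `∑ a_j z_j ^ n`; the first `N` of them form a Vandermonde
system. -/
theorem szego_pos {N : ℕ} {z : Fin N → ℂ} (hz : ∀ j, ‖z j‖ < 1) (hinj : Function.Injective z)
    {a : Fin N → ℂ} (ha : a ≠ 0) :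
    0 < (∑ j, ∑ k, a j * star (a k) * (1 - z j * star (z k))⁻¹).re := by
  refine (szego_nonneg hz a).lt_of_ne' fun h0 => ha ?_
  have hs := hasSum_szego hz a
  rw [h0, hasSum_zero_iff_of_nonneg (fun n => by positivity)] at hs
  refine Matrix.eq_zero_of_forall_pow_sum_mul_pow_eq_zero hinj fun i => ?_
  simpa using congrFun hs (i : ℕ)

/-! ### The two domains, their kernels and their boundaries. -/

namespace Region

/-- This reduces both domains to the Szegő kernel of the disc, up to a nonvanishing rescaling. -/
theorem exists_rho_inv_eq (Ω : Region) : ∃ φ g : ℂ → ℂ, Set.InjOn φ Ω.carrier ∧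
    (∀ z ∈ Ω.carrier, ‖φ z‖ < 1) ∧ (∀ z ∈ Ω.carrier, g z ≠ 0) ∧
    ∀ ω ∈ Ω.carrier, ∀ l ∈ Ω.carrier,
      (Ω.rho ω l)⁻¹ = g l * star (g ω) * (1 - φ l * star (φ ω))⁻¹ := by
  cases Ω with
  | disk =>
    exact ⟨id, 1, Set.injOn_id _, fun z hz => hz, fun _ _ => one_ne_zero, fun ω _ l _ => by
      simp [rho]⟩
  | halfPlane =>
    have hne : ∀ z ∈ halfPlane.carrier, z + 1 ≠ 0 := by
      intro z hz h
      have hz' : 0 < z.re := hz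
      have := congrArg Complex.re h
      simp at this
      linarith
    have hπ : (Real.pi : ℂ) ≠ 0 := by exact_mod_cast Real.pi_ne_zero
    have hsq : ((Real.sqrt Real.pi : ℝ) : ℂ) * ((Real.sqrt Real.pi : ℝ) : ℂ) = Real.pi := by
      rw [← Complex.ofReal_mul, Real.mul_self_sqrt Real.pi_pos.le]
    have hs : ((Real.sqrt Real.pi : ℝ) : ℂ) ≠ 0 := by
      intro h
      rw [h, zero_mul] at hsq
      exact hπ hsq.symm
    -- The Cayley transform; `√π` splits the constant of `ρ` evenly between the two variables.
    refine ⟨fun z => (z - 1) / (z + 1), fun z => (((Real.sqrt Real.pi : ℝ) : ℂ) * (z + 1))⁻¹,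
      ?_, ?_, fun z hz => inv_ne_zero (mul_ne_zero hs (hne z hz)), ?_⟩
    · intro z hz w hw h
      have := (div_eq_div_iff (hne z hz) (hne w hw)).1 h
      linear_combination this / 2
    · intro z hz
      have hz' : 0 < z.re := hz
      rw [norm_div, div_lt_one (norm_pos_iff.2 (hne z hz)), ← sq_lt_sq₀ (norm_nonneg _)
        (norm_nonneg _), ← Complex.normSq_eq_norm_sq, ← Complex.normSq_eq_norm_sq,
        Complex.normSq_apply, Complex.normSq_apply]
      simp
      nlinarith
    · intro ω hω l hl
      have h1 := hne l hl
      have h2 : (starRingEnd ℂ) ω + 1 ≠ 0 := by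
        have := (map_ne_zero (starRingEnd ℂ)).2 (hne ω hω)
        simpa using this
      have hl' : 0 < l.re := hl
      have hω' : 0 < ω.re := hω
      have h3 : l + (starRingEnd ℂ) ω ≠ 0 := by
        intro h
        have := congrArg Complex.re h
        simp at this
        linarith
      simp only [rho, RCLike.star_def, map_inv₀, map_mul, map_add, map_one, map_div₀, map_sub,
        Complex.conj_ofReal]
      have h4 : 1 - (l - 1) / (l + 1) * (((starRingEnd ℂ) ω - 1) / ((starRingEnd ℂ) ω + 1)) =
          2 * (l + (starRingEnd ℂ) ω) / ((l + 1) * ((starRingEnd ℂ) ω + 1)) := by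
        field_simp
        ring
      rw [h4, ← hsq]
      field_simp

theorem rho_ne_zero {Ω : Region} {ω l : ℂ} (hω : ω ∈ Ω.carrier) (hl : l ∈ Ω.carrier) :
    Ω.rho ω l ≠ 0 := by
  cases Ω with
  | disk =>
    intro h
    have h1 : ‖l * (starRingEnd ℂ) ω‖ = 1 := by rw [← sub_eq_zero.1 h, norm_one]
    rw [norm_mul, RCLike.norm_conj] at h1
    exact absurd h1 (mul_lt_one_of_nonneg_of_lt_one_left (norm_nonneg _) hl (le_of_lt hω)).ne
  | halfPlane =>
    have hl' : 0 < l.re := hl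
    have hω' : 0 < ω.re := hω
    have h3 : l + (starRingEnd ℂ) ω ≠ 0 := by
      intro h
      have := congrArg Complex.re h
      simp at this
      linarith
    have hπ : (Real.pi : ℂ) ≠ 0 := by exact_mod_cast Real.pi_ne_zero
    exact mul_ne_zero (mul_ne_zero two_ne_zero hπ) h3

theorem star_rho (Ω : Region) (ω l : ℂ) : star (Ω.rho ω l) = Ω.rho l ω := by
  cases Ω with
  | disk => simp [rho, mul_comm]
  | halfPlane => simp [rho, add_comm]

theorem continuous_rho (Ω : Region) : Continuous fun z : ℂ × ℂ => Ω.rho z.1 z.2 := by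
  cases Ω with
  | disk =>
    show Continuous fun z : ℂ × ℂ => 1 - z.2 * (starRingEnd ℂ) z.1
    fun_prop
  | halfPlane =>
    show Continuous fun z : ℂ × ℂ => 2 * (Real.pi : ℂ) * (z.2 + (starRingEnd ℂ) z.1)
    fun_prop

theorem isOpen_carrier (Ω : Region) : IsOpen Ω.carrier := by
  cases Ω with
  | disk => exact isOpen_lt continuous_norm continuous_const
  | halfPlane => exact isOpen_lt continuous_const Complex.continuous_re

theorem isPreconnected_carrier (Ω : Region) : IsPreconnected Ω.carrier := by
  cases Ω with
  | disk =>
    have : disk.carrier = Metric.ball (0 : ℂ) 1 := by ext; simp [carrier]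
    rw [this]
    exact (convex_ball _ _).isPreconnected
  | halfPlane => exact (convex_halfSpace_re_gt 0).isPreconnected

theorem nonempty_carrier (Ω : Region) : Ω.carrier.Nonempty := by
  cases Ω with
  | disk => exact ⟨0, by simp [carrier]⟩
  | halfPlane => exact ⟨1, by simp [carrier]⟩

theorem continuous_bdryDist (Ω : Region) : Continuous Ω.bdryDist := by
  cases Ω with
  | disk => exact continuous_const.sub continuous_norm
  | halfPlane => exact Complex.continuous_re

theorem isOpen_stolz (Ω : Region) (M : ℝ) (μ : ℂ) : IsOpen (Ω.stolz M μ) :=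
  Ω.isOpen_carrier.inter (isOpen_lt (by fun_prop) (continuous_const.mul Ω.continuous_bdryDist))

/-- Along the inner normal the distances to `μ` and to the boundary coincide, so any aperture above
`1` contains it near `μ`. -/
theorem mem_closure_stolz (Ω : Region) {M : ℝ} (hM : 1 < M) (t : ℝ) :
    Ω.bdryPoint t ∈ closure (Ω.stolz M (Ω.bdryPoint t)) := by
  cases Ω with
  | disk =>
    set μ := disk.bdryPoint t with hμ
    have hn : ‖μ‖ = 1 := Complex.norm_exp_ofReal_mul_I t
    have ht : Tendsto (fun r : ℝ => ((1 - r : ℝ) : ℂ) * μ) (𝓝[>] 0) (𝓝 μ) := by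
      have : Continuous fun r : ℝ => ((1 - r : ℝ) : ℂ) * μ := by fun_prop
      simpa using (this.tendsto 0).mono_left nhdsWithin_le_nhds
    refine mem_closure_of_tendsto ht ?_
    filter_upwards [Ioo_mem_nhdsGT (zero_lt_one' ℝ)] with r hr
    have h1 : ‖((1 - r : ℝ) : ℂ) * μ‖ = 1 - r := by
      rw [norm_mul, hn, mul_one, Complex.norm_real, Real.norm_of_nonneg (by linarith [hr.2])]
    have h2 : ‖((1 - r : ℝ) : ℂ) * μ - μ‖ = r := by
      rw [show ((1 - r : ℝ) : ℂ) * μ - μ = -((r : ℝ) : ℂ) * μ by push_cast; ring, norm_mul, hn,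
        mul_one, norm_neg, Complex.norm_real, Real.norm_of_nonneg hr.1.le]
    refine ⟨show ‖_‖ < 1 by rw [h1]; linarith [hr.1], ?_⟩
    rw [h2]
    simp only [bdryDist, h1]
    nlinarith [hr.1]
  | halfPlane =>
    set μ := halfPlane.bdryPoint t with hμ
    have hn : μ.re = 0 := by simp [hμ, bdryPoint]
    have ht : Tendsto (fun r : ℝ => μ + (r : ℂ)) (𝓝[>] 0) (𝓝 μ) := by
      have : Continuous fun r : ℝ => μ + (r : ℂ) := by fun_prop
      simpa using (this.tendsto 0).mono_left nhdsWithin_le_nhds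
    refine mem_closure_of_tendsto ht ?_
    filter_upwards [self_mem_nhdsWithin] with r hr
    have hr' : 0 < r := hr
    refine ⟨by simp [carrier, hn, hr'], ?_⟩
    simp only [bdryDist, add_sub_cancel_left, Complex.norm_real, Real.norm_of_nonneg hr'.le,
      Complex.add_re, hn, Complex.ofReal_re, zero_add]
    nlinarith

end Region

/-! ### Negative definite Gram matrices. -/

/-- If the kernel `-y(l) y(ω)^* / ρ_ω(l)` appears along `N` distinct points with nonzero vectors,
then the Gram matrix is negative definite. -/
theorem negCount_eq_of_szego {Ω : Region} {N : ℕ} {ω : Fin N → ℂ} (hω : ∀ j, ω j ∈ Ω.carrier)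
    (hinj : Function.Injective ω) {ι : Type*} [Fintype ι] {y : Fin N → ι → ℂ}
    (hy : ∀ j, y j ≠ 0) {A : Matrix (Fin N) (Fin N) ℂ} (hA : A.IsHermitian)
    (hAy : ∀ j k, A j k = -((Ω.rho (ω j) (ω k))⁻¹ * (star (y k) ⬝ᵥ y j))) :
    N ≤ negCount hA := by
  obtain ⟨φ, g, hφi, hφ, hg, hρ⟩ := Ω.exists_rho_inv_eq
  have key := card_le_negCount hA (1 : Matrix (Fin N) (Fin N) ℂ) fun c hc => ?_
  · simpa using key
  rw [Matrix.one_mulVec]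
  have hz : ∀ j, ‖star (φ (ω j))‖ < 1 := fun j => by rw [norm_star]; exact hφ _ (hω j)
  have hzi : Function.Injective fun j => star (φ (ω j)) := fun j k h =>
    hinj (hφi (hω j) (hω k) (star_injective h))
  -- The form splits over the coordinates `i` of the vectors `y` into negated Szegő sums; below, one
  -- coordinate with `c j ≠ 0` and `y j i ≠ 0` makes the total strict.
  have hsum : star c ⬝ᵥ (A *ᵥ c) = -∑ i, ∑ j, ∑ k,
      (star (c j) * star (g (ω j)) * y j i) * star (star (c k) * star (g (ω k)) * y k i) *
        (1 - star (φ (ω j)) * star (star (φ (ω k))))⁻¹ := by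
    rw [Finset.sum_comm]
    simp only [dotProduct, Matrix.mulVec, Finset.mul_sum]
    rw [← Finset.sum_neg_distrib]
    refine Finset.sum_congr rfl fun j _ => ?_
    rw [Finset.sum_comm, ← Finset.sum_neg_distrib]
    refine Finset.sum_congr rfl fun k _ => ?_
    rw [hAy, hρ _ (hω j) _ (hω k), dotProduct]
    simp only [Finset.mul_sum, Finset.sum_mul, ← Finset.sum_neg_distrib, mul_neg, neg_mul]
    refine Finset.sum_congr rfl fun i _ => ?_
    simp only [Pi.star_apply, star_mul', star_star]
    rw [mul_comm (φ (ω k))]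
    ring
  rw [hsum, Complex.neg_re, neg_lt_zero, Complex.re_sum]
  obtain ⟨j, hj⟩ := Function.ne_iff.1 hc
  obtain ⟨i, hi⟩ := Function.ne_iff.1 (hy j)
  refine Finset.sum_pos' (fun i _ => szego_nonneg hz _) ⟨i, Finset.mem_univ _, szego_pos hz hzi ?_⟩
  refine Function.ne_iff.2 ⟨j, mul_ne_zero (mul_ne_zero ?_ ?_) hi⟩
  · exact star_ne_zero.2 hj
  · exact star_ne_zero.2 (hg _ (hω j))

/-! ### Meromorphic matrix functions and codiscrete sets. -/

namespace MatMeromorphicOn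

variable {l m n : Type*} {U : Set ℂ}

theorem const (A : Matrix m n ℂ) : MatMeromorphicOn (fun _ => A) U :=
  fun i j => MeromorphicOn.const (A i j)

theorem neg {f : ℂ → Matrix m n ℂ} (hf : MatMeromorphicOn f U) :
    MatMeromorphicOn (fun z => -f z) U :=
  fun i j => (hf i j).fun_neg

theorem mul [Fintype m] {f : ℂ → Matrix l m ℂ} {g : ℂ → Matrix m n ℂ}
    (hf : MatMeromorphicOn f U) (hg : MatMeromorphicOn g U) :
    MatMeromorphicOn (fun z => f z * g z) U := by
  intro i j
  simp only [Matrix.mul_apply]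
  exact MeromorphicOn.fun_sum fun k => (hf i k).fun_mul (hg k j)

theorem det [Fintype m] [DecidableEq m] {f : ℂ → Matrix m m ℂ} (hf : MatMeromorphicOn f U) :
    MeromorphicOn (fun z => (f z).det) U := by
  simp only [Matrix.det_apply']
  exact MeromorphicOn.fun_sum fun σ => (MeromorphicOn.const _).fun_mul
    (MeromorphicOn.fun_prod fun i _ => hf _ _)

theorem inv [Fintype m] [DecidableEq m] {f : ℂ → Matrix m m ℂ} (hf : MatMeromorphicOn f U) :
    MatMeromorphicOn (fun z => (f z)⁻¹) U := by
  intro i j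
  simp only [Matrix.inv_def, Matrix.smul_apply, Ring.inverse_eq_inv', smul_eq_mul,
    Matrix.adjugate_apply]
  -- By Cramer's rule each adjugate entry is the determinant of `f z` with one row replaced by a
  -- constant row.
  refine hf.det.fun_inv.fun_mul (MatMeromorphicOn.det fun a b => ?_)
  by_cases h : a = j
  · subst h
    simpa using MeromorphicOn.const _
  · simpa [Matrix.updateRow_ne h] using hf a b

theorem fromCols {f : ℂ → Matrix l m ℂ} {g : ℂ → Matrix l n ℂ}
    (hf : MatMeromorphicOn f U) (hg : MatMeromorphicOn g U) :
    MatMeromorphicOn (fun z => Matrix.fromCols (f z) (g z)) U := by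
  rintro i (j | j)
  · exact hf i j
  · exact hg i j

theorem matNF_eventuallyEq [Finite m] [Finite n] {f : ℂ → Matrix m n ℂ}
    (hf : MatMeromorphicOn f U) : ∀ᶠ z in codiscreteWithin U, matNF U f z = f z := by
  have h : ∀ᶠ z in codiscreteWithin U, ∀ i j, f z i j = matNF U f z i j :=
    eventually_all.2 fun i => eventually_all.2 fun j => toMeromorphicNFOn_eqOn_codiscrete (hf i j)
  filter_upwards [h] with z hz
  ext i j
  exact (hz i j).symm

theorem matNF [Finite m] [Finite n] {f : ℂ → Matrix m n ℂ}
    (hf : MatMeromorphicOn f U) : MatMeromorphicOn (matNF U f) U :=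
  fun i j => (hf i j).congr_codiscreteWithin_of_eqOn_compl
    (toMeromorphicNFOn_eqOn_codiscrete (hf i j))
    (toMeromorphicNFOn_eq_self_on_compl (hf i j)).symm

theorem eventually_mem_holDomain [Finite m] [Finite n] {f : ℂ → Matrix m n ℂ}
    (hf : MatMeromorphicOn f U) : ∀ᶠ z in codiscreteWithin U, z ∈ holDomain U f := by
  have h : ∀ᶠ z in codiscreteWithin U, ∀ i j, AnalyticAt ℂ (fun w => GenSchur.matNF U f w i j) z :=
    eventually_all.2 fun i => eventually_all.2 fun j => (hf.matNF i j).analyticAt_mem_codiscreteWithin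
  filter_upwards [h, self_mem_codiscreteWithin U] with z hz hzU
  exact ⟨hzU, hz⟩

end MatMeromorphicOn

theorem continuousOn_matNF {m n : Type*} {U : Set ℂ} (f : ℂ → Matrix m n ℂ) :
    ContinuousOn (matNF U f) (holDomain U f) := by
  refine continuousOn_pi.2 fun i => continuousOn_pi.2 fun j => fun z hz => ?_
  exact (hz.2 i j).continuousAt.continuousWithinAt

theorem inter_mem_nhdsNE_of_codiscreteWithin {U S : Set ℂ} (hU : IsOpen U)
    (hS : S ∈ codiscreteWithin U) {x : ℂ} (hx : x ∈ U) : S ∩ U ∈ 𝓝[≠] x := by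
  filter_upwards [mem_codiscreteWithin_iff_forall_mem_nhdsNE.1 hS x hx,
    mem_nhdsWithin_of_mem_nhds (hU.mem_nhds hx)] with z hz hzU
  exact ⟨hz.resolve_right fun h => h hzU, hzU⟩

theorem subset_closure_of_codiscreteWithin {U S : Set ℂ} (hU : IsOpen U)
    (hS : S ∈ codiscreteWithin U) : U ⊆ closure (S ∩ U) := fun _ hx =>
  mem_closure_iff_nhdsWithin_neBot.2 <| NeBot.mono (inferInstance : (𝓝[≠] _).NeBot) <|
    le_inf nhdsWithin_le_nhds (le_principal_iff.2 (inter_mem_nhdsNE_of_codiscreteWithin hU hS hx))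

theorem infinite_of_codiscreteWithin {U S : Set ℂ} (hU : IsOpen U) (hne : U.Nonempty)
    (hS : S ∈ codiscreteWithin U) : (S ∩ U).Infinite := by
  obtain ⟨x, hx⟩ := hne
  have h := inter_mem_nhdsNE_of_codiscreteWithin hU hS hx
  intro hfin
  exact infinite_of_mem_nhds x (insert_mem_nhds_iff.2 h) (hfin.insert x)

/-- Identity theorem: infinite order at one point propagates through the connected set. -/
theorem eventually_ne_zero_or_eventually_eq_zero {U : Set ℂ} (hU : IsPreconnected U) {g : ℂ → ℂ}
    (hg : MeromorphicOn g U) :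
    (∀ᶠ z in codiscreteWithin U, g z ≠ 0) ∨ ∀ᶠ z in codiscreteWithin U, g z = 0 := by
  by_cases h : ∀ u ∈ U, meromorphicOrderAt g u ≠ ⊤
  · exact Or.inl (MeromorphicAt.MeromorphicOn.codiscreteWithin_setOfPred_ne_zero hg h)
  · push Not at h
    obtain ⟨u, hu, htop⟩ := h
    refine Or.inr (mem_codiscreteWithin_iff_forall_mem_nhdsNE.2 fun x hx => ?_)
    have hx0 : meromorphicOrderAt g x = ⊤ := by
      by_contra hne
      exact hg.meromorphicOrderAt_ne_top_of_isPreconnected hU hx hu hne htop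
    filter_upwards [meromorphicOrderAt_eq_top_iff.1 hx0] with z hz
    exact Or.inl hz

/-! ### Generic invertibility from the boundary values. -/

theorem jpq_mul_self (p q : ℕ) : jpq p q * jpq p q = 1 := by
  simp [jpq, Matrix.fromBlocks_multiply]

/-- A matrix function with `J`-unitary nontangential boundary values is generically invertible. -/
theorem eventually_isUnit_det_of_boundary {m : Type*} [Fintype m] [DecidableEq m] {Ω : Region}
    {J : Matrix m m ℂ} (hJ : IsUnit J.det) {W : ℂ → Matrix m m ℂ}
    (hW : MatMeromorphicOn W Ω.carrier)
    (hb : ∀ᵐ t : ℝ, ∃ L : Matrix m m ℂ,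
      HasNontangentialLimit Ω W (Ω.bdryPoint t) L ∧ J - L * J * Lᴴ = 0) :
    ∀ᶠ z in codiscreteWithin Ω.carrier, IsUnit (W z).det := by
  rcases eventually_ne_zero_or_eventually_eq_zero Ω.isPreconnected_carrier hW.det with h | h
  · filter_upwards [h] with z hz using isUnit_iff_ne_zero.2 hz
  exfalso
  obtain ⟨t, L, hL, hJL⟩ := hb.exists
  have hdet : L.det ≠ 0 := by
    intro h0
    rw [sub_eq_zero.1 hJL] at hJ
    simp [Matrix.det_mul, h0] at hJ
  set S := Ω.stolz 2 (Ω.bdryPoint t)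
  have hlim : Tendsto (fun z => (matNF Ω.carrier W z).det) (𝓝[S] Ω.bdryPoint t) (𝓝 L.det) := by
    have h1 : Tendsto (fun z => matNF Ω.carrier W z) (𝓝[S] Ω.bdryPoint t) (𝓝 L) :=
      tendsto_pi_nhds.2 fun i => tendsto_pi_nhds.2 fun j => hL 2 one_lt_two i j
    exact ((by fun_prop : Continuous fun A : Matrix m m ℂ => A.det).tendsto L).comp h1
  have hne := hlim.eventually_ne hdet
  rw [eventually_nhdsWithin_iff, eventually_nhds_iff] at hne
  obtain ⟨O, hO, hOo, hμ⟩ := hne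
  -- Near the boundary point the determinant is nonzero in the open Stolz angle, yet it vanishes on
  -- a codiscrete set, which meets every nonempty open subset of the domain.
  obtain ⟨z, hzO, hzS⟩ := mem_closure_iff.1 (Ω.mem_closure_stolz one_lt_two t) O hOo hμ
  have h0 : ∀ᶠ z in codiscreteWithin Ω.carrier, (matNF Ω.carrier W z).det = 0 := by
    filter_upwards [h, hW.matNF_eventuallyEq] with w hw hw'
    rw [hw', hw]
  have h1 := inter_mem_nhdsNE_of_codiscreteWithin Ω.isOpen_carrier h0 hzS.1
  have h2 : O ∩ S ∈ 𝓝[≠] z :=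
    mem_nhdsWithin_of_mem_nhds ((hOo.inter (Ω.isOpen_stolz _ _)).mem_nhds ⟨hzO, hzS⟩)
  obtain ⟨w, hw1, hw2⟩ := nonempty_of_mem (inter_mem h1 h2)
  exact hO w hw2.1 hw2.2 hw1.1

/-! ### Comparison of the admissible and the Schur kernels. -/

theorem conjTranspose_jpq (p q : ℕ) : (jpq p q)ᴴ = jpq p q := by
  simp [jpq, Matrix.fromBlocks_conjTranspose]

theorem isHermitianKernel_schurKernel {p q : ℕ} (Ω : Region) (s : ℂ → Matrix (Fin p) (Fin q) ℂ)
    (D : Set ℂ) : IsHermitianKernel (schurKernel Ω s) D := fun ω _ l _ => by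
  simp [schurKernel, Matrix.conjTranspose_smul, ← Ω.star_rho l ω]

theorem isHermitianKernel_admKernel {r m : Type*} [Fintype m] (Ω : Region) {J : Matrix m m ℂ}
    (hJ : Jᴴ = J) (X : ℂ → Matrix r m ℂ) (D : Set ℂ) :
    IsHermitianKernel (admKernel Ω J X) D := fun ω _ l _ => by
  simp [admKernel, Matrix.conjTranspose_smul, ← Ω.star_rho l ω, hJ, Matrix.mul_assoc]

theorem continuousOn_rho_inv {Ω : Region} {D : Set ℂ} (hD : D ⊆ Ω.carrier) :
    ContinuousOn (fun z : ℂ × ℂ => (Ω.rho z.1 z.2)⁻¹) (D ×ˢ D) :=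
  Ω.continuous_rho.continuousOn.inv₀ fun _ hz => Region.rho_ne_zero (hD hz.1) (hD hz.2)

theorem continuousOn_schurKernel {p q : ℕ} {Ω : Region} {s : ℂ → Matrix (Fin p) (Fin q) ℂ}
    {D : Set ℂ} (hD : D ⊆ Ω.carrier) (hs : ContinuousOn s D) (i j : Fin p) :
    ContinuousOn (fun z : ℂ × ℂ => schurKernel Ω s z.1 z.2 i j) (D ×ˢ D) := by
  have h1 : ContinuousOn (fun z : ℂ × ℂ => s z.1) (D ×ˢ D) :=
    hs.comp continuous_fst.continuousOn fun _ hz => hz.1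
  have h2 : ContinuousOn (fun z : ℂ × ℂ => s z.2) (D ×ˢ D) :=
    hs.comp continuous_snd.continuousOn fun _ hz => hz.2
  have h3 : ContinuousOn (fun z : ℂ × ℂ => schurKernel Ω s z.1 z.2) (D ×ˢ D) := by
    rw [continuousOn_iff_continuous_domRestrict] at h1 h2 ⊢
    have h0 := continuousOn_iff_continuous_domRestrict.1 (continuousOn_rho_inv hD)
    exact h0.smul (continuous_const.sub (h2.matrix_mul h1.matrix_conjTranspose))
  exact continuousOn_pi.1 (continuousOn_pi.1 h3 i) j

theorem continuousOn_admKernel {r m : Type*} [Fintype m] {Ω : Region} (J : Matrix m m ℂ)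
    {X : ℂ → Matrix r m ℂ} {D : Set ℂ} (hD : D ⊆ Ω.carrier) (hX : ContinuousOn X D) (i j : r) :
    ContinuousOn (fun z : ℂ × ℂ => admKernel Ω J X z.1 z.2 i j) (D ×ˢ D) := by
  have h1 : ContinuousOn (fun z : ℂ × ℂ => X z.1) (D ×ˢ D) :=
    hX.comp continuous_fst.continuousOn fun _ hz => hz.1
  have h2 : ContinuousOn (fun z : ℂ × ℂ => X z.2) (D ×ˢ D) :=
    hX.comp continuous_snd.continuousOn fun _ hz => hz.2
  have h3 : ContinuousOn (fun z : ℂ × ℂ => admKernel Ω J X z.1 z.2) (D ×ˢ D) := by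
    rw [continuousOn_iff_continuous_domRestrict] at h1 h2 ⊢
    have h0 := continuousOn_iff_continuous_domRestrict.1 (continuousOn_rho_inv hD)
    exact h0.smul ((h2.matrix_mul continuous_const).matrix_mul h1.matrix_conjTranspose)
  exact continuousOn_pi.1 (continuousOn_pi.1 h3 i) j

theorem fromCols_mul_jpq_mul_conjTranspose {r : Type*} {p q : ℕ} (a c : Matrix r (Fin p) ℂ)
    (b d : Matrix r (Fin q) ℂ) :
    Matrix.fromCols a b * jpq p q * (Matrix.fromCols c d)ᴴ = a * cᴴ - b * dᴴ := by
  rw [jpq, Matrix.fromCols_mul_fromBlocks, Matrix.conjTranspose_fromCols_eq_fromRows_conjTranspose,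
    Matrix.fromCols_mul_fromRows]
  simp [sub_eq_add_neg]

/-- If `X = x₁ [I, -ε]` with `x₁` generically invertible, then the kernels of `X` and of `ε` have
the same number of negative squares. -/
theorem isAdmissible_iff_isGenSchur {p q : ℕ} {Ω : Region} {κ : ℕ}
    {X : ℂ → Matrix (Fin p) (Fin p ⊕ Fin q) ℂ} {x₁ : ℂ → Matrix (Fin p) (Fin p) ℂ}
    {ε : ℂ → Matrix (Fin p) (Fin q) ℂ} (hX : MatMeromorphicOn X Ω.carrier)
    (hε : MatMeromorphicOn ε Ω.carrier)
    (h : ∀ᶠ z in codiscreteWithin Ω.carrier,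
      IsUnit (x₁ z).det ∧ X z = x₁ z * Matrix.fromCols (1 : Matrix (Fin p) (Fin p) ℂ) (-(ε z))) :
    IsAdmissible Ω (jpq p q) κ X ↔ IsGenSchur Ω κ ε := by
  have hall := ((hX.eventually_mem_holDomain.and hε.eventually_mem_holDomain).and
    (hX.matNF_eventuallyEq.and hε.matNF_eventuallyEq)).and h
  -- Here the canonical representatives agree with the given values and the factorization holds;
  -- being dense, this set suffices for both counts.
  set D₀ := {z | ((z ∈ holDomain Ω.carrier X ∧ z ∈ holDomain Ω.carrier ε) ∧
    matNF Ω.carrier X z = X z ∧ matNF Ω.carrier ε z = ε z) ∧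
      IsUnit (x₁ z).det ∧ X z = x₁ z * Matrix.fromCols (1 : Matrix (Fin p) (Fin p) ℂ) (-(ε z))}
  have hdense : Ω.carrier ⊆ closure D₀ :=
    (subset_closure_of_codiscreteWithin Ω.isOpen_carrier hall).trans
      (closure_mono Set.inter_subset_left)
  have hK : ∀ ω ∈ D₀, ∀ l ∈ D₀, admKernel Ω (jpq p q) (matNF Ω.carrier X) ω l =
      x₁ l * schurKernel Ω (matNF Ω.carrier ε) ω l * (x₁ ω)ᴴ := by
    rintro ω ⟨⟨-, h1, h2⟩, -, h3⟩ l ⟨⟨-, h1', h2'⟩, -, h3'⟩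
    rw [admKernel, schurKernel, h1, h2, h1', h2', h3, h3', Matrix.conjTranspose_mul,
      Matrix.mul_smul, Matrix.smul_mul]
    congr 1
    calc _ = x₁ l * (Matrix.fromCols (1 : Matrix (Fin p) (Fin p) ℂ) (-(ε l)) * jpq p q *
          (Matrix.fromCols (1 : Matrix (Fin p) (Fin p) ℂ) (-(ε ω)))ᴴ) * (x₁ ω)ᴴ := by simp only [Matrix.mul_assoc]
      _ = _ := by rw [fromCols_mul_jpq_mul_conjTranspose]; simp
  have hX₀ := hasNegSquares_iff_of_dense (κ := κ)
    (isHermitianKernel_admKernel Ω (conjTranspose_jpq p q) (matNF Ω.carrier X)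
      (holDomain Ω.carrier X)) (D₀ := D₀) (fun z hz => hz.1.1.1) (fun z hz => hdense hz.1)
    (continuousOn_admKernel _ (fun z hz => hz.1) (continuousOn_matNF X))
  have hε₀ := hasNegSquares_iff_of_dense (κ := κ)
    (isHermitianKernel_schurKernel Ω (matNF Ω.carrier ε)
      (holDomain Ω.carrier ε)) (D₀ := D₀) (fun z hz => hz.1.1.2) (fun z hz => hdense hz.1)
    (continuousOn_schurKernel (fun z hz => hz.1) (continuousOn_matNF ε))
  have hinv : ∀ z ∈ D₀, (x₁ z)⁻¹ * x₁ z = 1 := fun z hz => Matrix.nonsing_inv_mul _ hz.2.1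
  have hinv' : ∀ z ∈ D₀, x₁ z * (x₁ z)⁻¹ = 1 := fun z hz => Matrix.mul_nonsing_inv _ hz.2.1
  refine ⟨fun hA => ⟨hε, hε₀.2 ?_⟩, fun hS => ⟨hX, hX₀.2 ?_⟩⟩
  · refine (hX₀.1 hA.negSquares).of_congruence (fun z => (x₁ z)⁻¹) x₁ hinv' fun ω hω l hl => ?_
    have h1 : (x₁ ω)ᴴ * ((x₁ ω)⁻¹)ᴴ = 1 := by
      rw [← Matrix.conjTranspose_mul, hinv ω hω, Matrix.conjTranspose_one]
    rw [hK ω hω l hl, Matrix.mul_assoc, Matrix.mul_assoc, Matrix.mul_assoc, h1, Matrix.mul_one,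
      ← Matrix.mul_assoc, hinv l hl, Matrix.one_mul]
  · exact (hε₀.1 hS.negSquares).of_congruence x₁ (fun z => (x₁ z)⁻¹) hinv hK

/-! ### Generic invertibility of the left block. -/

theorem eq_zero_of_vecMul_fromCols_mul {p q : ℕ} {s : Matrix (Fin p) (Fin q) ℂ}
    {W : Matrix (Fin p ⊕ Fin q) (Fin p ⊕ Fin q) ℂ} (hW : IsUnit W.det) {u : Fin p → ℂ}
    (hu : u ᵥ* (Matrix.fromCols (1 : Matrix (Fin p) (Fin p) ℂ) (-s) * W) = 0) : u = 0 := by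
  rw [← Matrix.vecMul_vecMul] at hu
  have h := Matrix.eq_zero_of_vecMul_eq_zero hW.ne_zero hu
  rw [Matrix.vecMul_fromCols] at h
  funext i
  simpa using congrFun h (Sum.inl i)

/-- The left block of an admissible function of full rank is generically invertible. -/
theorem eventually_isUnit_det_toCols₁ {p q : ℕ} {Ω : Region} {κ : ℕ}
    {X : ℂ → Matrix (Fin p) (Fin p ⊕ Fin q) ℂ} (hX : IsAdmissible Ω (jpq p q) κ X)
    (hrank : ∀ᶠ z in codiscreteWithin Ω.carrier, ∀ u, u ᵥ* X z = 0 → u = 0) :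
    ∀ᶠ z in codiscreteWithin Ω.carrier, IsUnit (X z).toCols₁.det := by
  have hm : MatMeromorphicOn (fun z => (X z).toCols₁) Ω.carrier :=
    fun i j => hX.meromorphic i (Sum.inl j)
  rcases eventually_ne_zero_or_eventually_eq_zero Ω.isPreconnected_carrier hm.det with h | h
  · filter_upwards [h] with z hz using isUnit_iff_ne_zero.2 hz
  exfalso
  have hall := (hX.meromorphic.eventually_mem_holDomain.and
    hX.meromorphic.matNF_eventuallyEq).and (hrank.and h)
  have hinf := infinite_of_codiscreteWithin Ω.isOpen_carrier Ω.nonempty_carrier hall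
  have hvec : ∀ z : ℂ, (∀ u, u ᵥ* X z = 0 → u = 0) → (X z).toCols₁.det = 0 →
      ∃ (u : Fin p → ℂ) (y : Fin q → ℂ), y ≠ 0 ∧ (X z)ᴴ *ᵥ u = Sum.elim (0 : Fin p → ℂ) y := by
    intro z hr hd
    obtain ⟨v, hv, hv0⟩ := Matrix.exists_vecMul_eq_zero_iff.2 hd
    have h1 : (X z)ᴴ *ᵥ star v = Sum.elim (0 : Fin p → ℂ) (star (v ᵥ* (X z).toCols₂)) := by
      rw [Matrix.mulVec_conjTranspose, star_star]
      conv_lhs => rw [← Matrix.fromCols_toCols (X z), Matrix.vecMul_fromCols, hv0]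
      funext i
      cases i <;> simp
    -- If `y` vanished too, `v` would annihilate all of `X z`, against full row rank.
    refine ⟨star v, _, fun h0 => hv (hr v ?_), h1⟩
    rw [h0, Matrix.mulVec_conjTranspose, star_star] at h1
    rw [← star_eq_zero, h1]
    funext i
    cases i <;> rfl
  let e := hinf.natEmbedding
  have he : ∀ n, (e n : ℂ) ∈ _ := fun n => (e n).2
  choose u y hy hu using fun n => hvec (e n) (he n).1.2.1 (he n).1.2.2
  -- One point more than the number of negative squares allows.
  let ω : Fin (κ + 1) → ℂ := fun j => e j
  have hω : ∀ j, ω j ∈ holDomain Ω.carrier X := fun j => (he j).1.1.1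
  have hle := hX.negSquares.le (κ + 1) ω (fun j => u j) hω
  refine absurd (le_trans ?_ hle) (Nat.not_succ_le_self κ)
  refine negCount_eq_of_szego (fun j => (he j).2) (fun j k hjk => ?_) (fun j => hy j) _ ?_
  · exact Fin.val_injective (e.injective (Subtype.ext hjk))
  · intro j k
    simp only [kernelGram, Matrix.of_apply, admKernel, Matrix.smul_mulVec, dotProduct_smul,
      smul_eq_mul]
    rw [show matNF Ω.carrier X (ω j) = X (ω j) from (he j).1.1.2,
      show matNF Ω.carrier X (ω k) = X (ω k) from (he k).1.1.2, ← mul_neg]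
    congr 1
    -- As the first component of `X^* u` is zero, only the block `-I_q` of `j` contributes.
    rw [← Matrix.mulVec_mulVec, ← Matrix.mulVec_mulVec, hu j, Matrix.dotProduct_mulVec,
      ← Matrix.conjTranspose_conjTranspose (X (ω k)), ← Matrix.star_mulVec, hu k, jpq,
      Matrix.fromBlocks_mulVec]
    simp [dotProduct, Fintype.sum_sum_type, Matrix.neg_mulVec]

/-! ### Algebra of the linear fractional transformation. -/

theorem toCols₁_fromCols_mul {p q : ℕ} (s : Matrix (Fin p) (Fin q) ℂ)
    (W : Matrix (Fin p ⊕ Fin q) (Fin p ⊕ Fin q) ℂ) :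
    (Matrix.fromCols (1 : Matrix (Fin p) (Fin p) ℂ) (-s) * W).toCols₁ = W.toBlocks₁₁ - s * W.toBlocks₂₁ := by
  conv_lhs => rw [← Matrix.fromBlocks_toBlocks W, Matrix.fromCols_mul_fromBlocks]
  simp [sub_eq_add_neg]

theorem toCols₂_fromCols_mul {p q : ℕ} (s : Matrix (Fin p) (Fin q) ℂ)
    (W : Matrix (Fin p ⊕ Fin q) (Fin p ⊕ Fin q) ℂ) :
    (Matrix.fromCols (1 : Matrix (Fin p) (Fin p) ℂ) (-s) * W).toCols₂ = W.toBlocks₁₂ - s * W.toBlocks₂₂ := by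
  conv_lhs => rw [← Matrix.fromBlocks_toBlocks W, Matrix.fromCols_mul_fromBlocks]
  simp [sub_eq_add_neg]

/-- `[I, -s] W [ε; I] = 0` in terms of the numerator and the denominator of `T_W[ε]`. -/
theorem toCols_mul_add_toCols {p q : ℕ} (s ε : Matrix (Fin p) (Fin q) ℂ)
    (W : Matrix (Fin p ⊕ Fin q) (Fin p ⊕ Fin q) ℂ) :
    (Matrix.fromCols (1 : Matrix (Fin p) (Fin p) ℂ) (-s) * W).toCols₁ * ε + (Matrix.fromCols (1 : Matrix (Fin p) (Fin p) ℂ) (-s) * W).toCols₂ =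
      (W.toBlocks₁₁ * ε + W.toBlocks₁₂) - s * (W.toBlocks₂₁ * ε + W.toBlocks₂₂) := by
  rw [toCols₁_fromCols_mul, toCols₂_fromCols_mul, Matrix.sub_mul, Matrix.mul_add, Matrix.mul_assoc]
  abel

theorem eq_mul_fromCols_of_toCols_mul_add {p q : ℕ} {X : Matrix (Fin p) (Fin p ⊕ Fin q) ℂ}
    {ε : Matrix (Fin p) (Fin q) ℂ} (h : X.toCols₁ * ε + X.toCols₂ = 0) :
    X = X.toCols₁ * Matrix.fromCols (1 : Matrix (Fin p) (Fin p) ℂ) (-ε) := by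
  conv_lhs => rw [← Matrix.fromCols_toCols X]
  rw [Matrix.mul_fromCols, Matrix.mul_one, Matrix.mul_neg, eq_neg_of_add_eq_zero_right h]

/-- A null vector `v` of the denominator is also one of the numerator, so `W` annihilates `(ε v,
v)`. -/
theorem isUnit_det_denom {p q : ℕ} {s ε : Matrix (Fin p) (Fin q) ℂ}
    {W : Matrix (Fin p ⊕ Fin q) (Fin p ⊕ Fin q) ℂ} (hW : IsUnit W.det)
    (h : W.toBlocks₁₁ * ε + W.toBlocks₁₂ = s * (W.toBlocks₂₁ * ε + W.toBlocks₂₂)) :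
    IsUnit (W.toBlocks₂₁ * ε + W.toBlocks₂₂).det := by
  rw [isUnit_iff_ne_zero]
  intro h0
  obtain ⟨v, hv, hv0⟩ := Matrix.exists_mulVec_eq_zero_iff.2 h0
  have h1 : (W.toBlocks₁₁ * ε + W.toBlocks₁₂) *ᵥ v = 0 := by
    rw [h, ← Matrix.mulVec_mulVec, hv0, Matrix.mulVec_zero]
  rw [Matrix.add_mulVec, ← Matrix.mulVec_mulVec] at hv0 h1
  have h2 : W *ᵥ Sum.elim (ε *ᵥ v) v = 0 := by
    conv_lhs => rw [← Matrix.fromBlocks_toBlocks W, Matrix.fromBlocks_mulVec]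
    simp only [Sum.elim_comp_inl, Sum.elim_comp_inr, hv0, h1]
    funext i
    cases i <;> rfl
  have h3 := Matrix.eq_zero_of_mulVec_eq_zero hW.ne_zero h2
  exact hv (funext fun i => congrFun h3 (Sum.inr i))

end GenSchur

open GenSchur
theorem theorem3p3 (Ω : Region) (p q κ κ₁ : ℕ) (hκ : κ₁ ≤ κ)
    (s : ℂ → Matrix (Fin p) (Fin q) ℂ) (hs : IsGenSchur Ω κ s)
    (W : ℂ → Matrix (Fin p ⊕ Fin q) (Fin p ⊕ Fin q) ℂ) (hW : IsGenInner Ω κ₁ (jpq p q) W) :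
    s ∈ lftImage Ω W (κ - κ₁) ↔
      IsAdmissible Ω (jpq p q) (κ - κ₁)
        (fun z => Matrix.fromCols (1 : Matrix (Fin p) (Fin p) ℂ) (-(s z)) * W z) := by
  have hX : MatMeromorphicOn
      (fun z => Matrix.fromCols (1 : Matrix (Fin p) (Fin p) ℂ) (-(s z)) * W z) Ω.carrier :=
    ((MatMeromorphicOn.const 1).fromCols hs.meromorphic.neg).mul hW.meromorphic
  have hWu : ∀ᶠ z in codiscreteWithin Ω.carrier, IsUnit (W z).det :=
    eventually_isUnit_det_of_boundary
      (Matrix.isUnit_det_of_left_inverse (jpq_mul_self p q)) hW.meromorphic hW.boundary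
  constructor
  · rintro ⟨ε, hε, hlft⟩
    refine (isAdmissible_iff_isGenSchur hX hε.meromorphic (x₁ := fun z =>
      (Matrix.fromCols (1 : Matrix (Fin p) (Fin p) ℂ) (-(s z)) * W z).toCols₁) ?_).2 hε
    filter_upwards [hWu, hlft] with z hWz hz
    have h0 := toCols_mul_add_toCols (s z) (ε z) (W z)
    have hsz : s z * lftDenom W ε z = (W z).toBlocks₁₁ * ε z + (W z).toBlocks₁₂ := by
      rw [hz.2, lft, Matrix.mul_assoc, Matrix.nonsing_inv_mul _ hz.1, Matrix.mul_one]
    rw [← hsz, lftDenom, sub_self] at h0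
    have hfac := eq_mul_fromCols_of_toCols_mul_add h0
    refine ⟨isUnit_iff_ne_zero.2 fun hdet => ?_, hfac⟩
    -- A left null vector of `x₁` would be one of `X = x₁ [I, -ε]`, whose rows are independent.
    obtain ⟨u, hu, hu0⟩ := Matrix.exists_vecMul_eq_zero_iff.2 hdet
    refine hu (eq_zero_of_vecMul_fromCols_mul hWz (s := s z) ?_)
    rw [hfac, ← Matrix.vecMul_vecMul, hu0, Matrix.zero_vecMul]
  · intro hA
    have hdet := eventually_isUnit_det_toCols₁ hA (by
      filter_upwards [hWu] with z hWz u hu using eq_zero_of_vecMul_fromCols_mul hWz hu)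
    set X := fun z => Matrix.fromCols (1 : Matrix (Fin p) (Fin p) ℂ) (-(s z)) * W z
    have hm₁ : MatMeromorphicOn (fun z => (X z).toCols₁) Ω.carrier := fun i j => hX i (Sum.inl j)
    have hm₂ : MatMeromorphicOn (fun z => (X z).toCols₂) Ω.carrier := fun i j => hX i (Sum.inr j)
    have hzero : ∀ z, IsUnit (X z).toCols₁.det →
        (X z).toCols₁ * -((X z).toCols₁⁻¹ * (X z).toCols₂) + (X z).toCols₂ = 0 := by
      intro z hz
      rw [Matrix.mul_neg, ← Matrix.mul_assoc, Matrix.mul_nonsing_inv _ hz, Matrix.one_mul,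
        neg_add_cancel]
    -- The parameter is forced by `x₁ ε + x₂ = 0`.
    refine ⟨fun z => -((X z).toCols₁⁻¹ * (X z).toCols₂), ?_, ?_⟩
    · refine (isAdmissible_iff_isGenSchur hX (hm₁.inv.mul hm₂).neg
        (x₁ := fun z => (X z).toCols₁) ?_).1 hA
      filter_upwards [hdet] with z hz
      exact ⟨hz, eq_mul_fromCols_of_toCols_mul_add (hzero z hz)⟩
    · filter_upwards [hdet, hWu] with z hz hWz
      have h0 := hzero z hz
      rw [toCols_mul_add_toCols, sub_eq_zero] at h0
      have hu := isUnit_det_denom hWz h0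
      refine ⟨hu, ?_⟩
      rw [lft, h0, lftDenom, Matrix.mul_assoc, Matrix.mul_nonsing_inv _ hu, Matrix.mul_one]
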